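/- Conventions. Let $1\le n\le\omega$. For Boolean algebras write $\cdot,\prod$ for meets, and $\langle X\rangle$ for the subalgebra generated by $X$. If $A,B$ are nontrivial Boolean algebras and $U\subseteq A$, a function $f:U\to B$ is \emph{$n$-preserving} (for $n<\omega$) if for all $a_0,\dots,a_{n-1}\in U$, $\prod_{i<n}a_i=0$ implies $\prod_{i<n}f(a_i)=0$; it is \emph{$\omega$-preserving} if for every finite $S\subseteq U$, $\prod S=0$ implies $\prod f[S]=0$. A nontrivial Boolean algebra $A$ is \emph{$n$-free over} $X\subseteq A$ if every $n$-preserving function from $X$ into an arbitrary nontrivial Boolean algebra $B$ extends to a unique homomorphism $A\to B$; it is \emph{$n$-free} if it is $n$-free over some subset. If $C\le A_i\le A$ for $i\in I$, then $A$ is the \emph{amalgamated free product} of the $A_i$ over $C$ if for every Boolean algebra $B$ and all homomorphisms $f_i:A_i\to B$ with $f_i\restriction C=f_j\restriction C$ for all $i,j\in I$ there is a unique homomorphism $A\to B$ extending all $f_i$. The \emph{free product} of Boolean algebras $A_i$ is their coproduct $(F,(e_i:A_i\to F)_{i\in I})$. For a (simple) graph $\mathscr G$ with vertex set $V$, the clique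 space of $\mathscr G$ is the subspace of $2^V$ of all characteristic functions of complete subgraphs of $\mathscr G$; a \emph{graph space} is a topological space homeomorphic to the clique space of some graph. Theorem. (1) Let $A$ be a Boolean algebra with subalgebras $C\le A_i\le A$ $(i\in I)$ such that $A$ is the amalgamated free product of the $A_i$ over $C$. Suppose that $A_i\cap A_j=C$ for $i\ne j$, that each $A_i$ is $n$-free over $H_i\subseteq A_i$, and that $C\le\langle H_i\cap H_j\rangle$ for $i\neq j$. Then $A$ is $n$-free over $\bigcup_{i\in I}H_i$. (2) In particular, if $F$ with $e_i:A_i\to F$ is the free product of Boolean algebras $A_i$ $(i\in I)$ and each $A_i$ is $n$-free over $H_i$, then $F$ is $n$-free over $\bigcup_{i\in I}e_i[H_i]$; hence every free product of $n$-free Boolean algebras is $n$-free. (3) Dually, an arbitrary (topological) product of graph spaces is a graph space. -/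

import Mathlib

universe u v w t

/-- For `1 ≤ n < ω`, a function `f` defined on a subset `U` of a Boolean algebra is `n`-preserving
if `a₀ · … · aₙ₋₁ = 0` implies `f a₀ · … · f aₙ₋₁ = 0` for all `a₀, …, aₙ₋₁ ∈ U` (repetitions
allowed); it is `ω`-preserving if `∏ S = 0` implies `∏ f[S] = 0` for every finite `S ⊆ U`.
Here `ω` is represented by `⊤ : ℕ∞`. -/
def IsPreserving {A : Type u} [BooleanAlgebra A] {B : Type w} [BooleanAlgebra B]
    (n : ℕ∞) {U : Set A} (f : U → B) : Prop :=
  (∀ k : ℕ, n = (k : ℕ∞) → ∀ a : Fin k → U,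
    Finset.univ.inf (fun i => (a i : A)) = ⊥ → Finset.univ.inf (fun i => f (a i)) = ⊥) ∧
  (n = ⊤ → ∀ S : Finset U, S.inf (fun x => (x : A)) = ⊥ → S.inf f = ⊥)

/-- A nontrivial Boolean algebra `A` is `n`-free over its subset `X` if every `n`-preserving
function from `X` to a nontrivial Boolean algebra `B` extends to a unique homomorphism `A → B`. -/
structure IsNFreeOver (A : Type u) [BooleanAlgebra A] (n : ℕ∞) (X : Set A) : Prop where
  nontrivial : Nontrivial A
  existsUnique_extension : ∀ (B : Type w) [BooleanAlgebra B] [Nontrivial B] (f : X → B),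
    IsPreserving n f → ∃! φ : BoundedLatticeHom A B, ∀ x : X, φ (x : A) = f x

/-- A Boolean algebra is `n`-free if it is `n`-free over some subset. -/
def IsNFree (A : Type u) [BooleanAlgebra A] (n : ℕ∞) : Prop :=
  ∃ X : Set A, IsNFreeOver.{u, w} A n X

/-- The Boolean algebra `A` is the amalgamated free product over its subalgebra `C` of its
subalgebras `S i`, each of which contains `C`: every family of homomorphisms `S i → B` which agree
on `C` has a unique common extension to a homomorphism `A → B`. -/
structure IsAmalgamatedFreeProduct {A : Type u} [BooleanAlgebra A] {I : Type v}
    (C : BooleanSubalgebra A) (S : I → BooleanSubalgebra A) : Prop where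
  le : ∀ i, C ≤ S i
  existsUnique_lift : ∀ (B : Type w) [BooleanAlgebra B] (f : ∀ i, BoundedLatticeHom (S i) B),
    (∀ i j, ∀ c : C,
      f i (BooleanSubalgebra.inclusion (le i) c) = f j (BooleanSubalgebra.inclusion (le j) c)) →
    ∃! φ : BoundedLatticeHom A B, ∀ i, ∀ a : S i, φ (a : A) = f i a

/-- `F`, with the homomorphisms `e i : A i → F`, is the free product (the coproduct) of the
Boolean algebras `A i`. -/
def IsFreeProduct {I : Type v} {A : I → Type u} [∀ i, BooleanAlgebra (A i)]
    {F : Type t} [BooleanAlgebra F] (e : ∀ i, BoundedLatticeHom (A i) F) : Prop :=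
  ∀ (B : Type w) [BooleanAlgebra B] (f : ∀ i, BoundedLatticeHom (A i) B),
    ∃! φ : BoundedLatticeHom F B, ∀ i, ∀ a : A i, φ (e i a) = f i a

/-- The set of (characteristic functions of) complete subgraphs of `G`. Its subspace topology
inherited from `2 ^ V` has the sets `{f | f v = 1}` and `{f | f v = 0}`, `v ∈ V`, as a subbase. -/
def cliqueSpace {V : Type u} (G : SimpleGraph V) : Set (V → Bool) :=
  {f | G.IsClique {v | f v = true}}

/-- A graph space is a topological space homeomorphic to the clique space of some graph.
(The vertices of `G` embed into the clique space as singletons, so that a graph with vertices in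
the universe of `X` can always be taken.) -/
def IsGraphSpace (X : Type u) [TopologicalSpace X] : Prop :=
  ∃ (V : Type u) (G : SimpleGraph V), Nonempty (X ≃ₜ cliqueSpace G)

/-!
An `n`-preserving function on `⋃ i, H i` restricts to an `n`-preserving function on each `H i`, and
so extends to a homomorphism on each `A i`. These homomorphisms agree on the common generators,
hence on the subalgebra generated by them, which contains the amalgamated subalgebra `C`, and the
universal property of the amalgamated free product glues them. For a free product there is nothing
to agree on. Nontriviality comes from the same argument applied to the constant function `⊥`, which
is always `n`-preserving.

Dually, a clique in the join of a family of graphs is the same thing as a choice of one clique in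
each of them.
-/

section BooleanAlgebra

variable {A A' B : Type*} [BooleanAlgebra A] [BooleanAlgebra A'] [BooleanAlgebra B] {n : ℕ∞}

theorem IsPreserving.comp_mapsTo {U : Set A} {V : Set A'} {f : V → B} (hf : IsPreserving n f)
    (g : BoundedLatticeHom A A') (hg : Set.MapsTo g U V) :
    IsPreserving n (f ∘ hg.restrict g U V) := by
  classical
  refine ⟨fun k hk a ha => hf.1 k hk (hg.restrict g U V ∘ a) ?_, fun hn T hT => ?_⟩
  · simpa [map_finset_inf, Function.comp_def] using congrArg g ha
  · have image_inf_eq_bot : (T.image (hg.restrict g U V)).inf (fun y => (y : A')) = ⊥ := by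
      simpa [Finset.inf_image, map_finset_inf, Function.comp_def] using congrArg g hT
    simpa [Finset.inf_image] using hf.2 hn _ image_inf_eq_bot

theorem nonempty_of_finset_inf_eq_bot {L ι : Type*} [SemilatticeInf L] [BoundedOrder L]
    [Nontrivial L] {s : Finset ι} {a : ι → L} (h : s.inf a = ⊥) : s.Nonempty := by
  rw [Finset.nonempty_iff_ne_empty]
  rintro rfl
  exact top_ne_bot h

theorem isPreserving_const_bot [Nontrivial A] {U : Set A} :
    IsPreserving n (fun _ : U => (⊥ : B)) :=
  ⟨fun _ _ _ h => Finset.inf_const (nonempty_of_finset_inf_eq_bot h) ⊥,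
    fun _ _ h => Finset.inf_const (nonempty_of_finset_inf_eq_bot h) ⊥⟩

theorem nontrivial_of_boundedLatticeHom {L M : Type*} [Lattice L] [BoundedOrder L] [Lattice M]
    [BoundedOrder M] [Nontrivial M] (φ : BoundedLatticeHom L M) : Nontrivial L :=
  ⟨⊥, ⊤, fun h => bot_ne_top (α := M) (by rw [← map_bot φ, h, map_top])⟩

theorem boundedLatticeHom_ext_closure {s : Set A}
    {f g : BoundedLatticeHom (BooleanSubalgebra.closure s) B}
    (h : ∀ a (ha : a ∈ s), f ⟨a, BooleanSubalgebra.subset_closure ha⟩ =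
      g ⟨a, BooleanSubalgebra.subset_closure ha⟩) : f = g := by
  ext ⟨a, ha⟩
  induction ha using BooleanSubalgebra.closure_bot_sup_induction with
  | mem a ha => exact h a ha
  | bot => exact (map_bot f).trans (map_bot g).symm
  | sup a ha b hb iha ihb =>
    rw [← BooleanSubalgebra.mk_sup_mk a b ha hb, map_sup, map_sup, iha, ihb]
  | compl a ha iha => rw [← BooleanSubalgebra.compl_mk a ha, map_compl', map_compl', iha]

theorem apply_eq_apply_of_mem_closure {S T : BooleanSubalgebra A} {s : Set A}
    (hS : s ⊆ S) (hT : s ⊆ T) {f : BoundedLatticeHom S B} {g : BoundedLatticeHom T B}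
    (h : ∀ a (ha : a ∈ s), f ⟨a, hS ha⟩ = g ⟨a, hT ha⟩)
    {a : A} (ha : a ∈ BooleanSubalgebra.closure s) :
    f ⟨a, BooleanSubalgebra.closure_le.2 hS ha⟩ = g ⟨a, BooleanSubalgebra.closure_le.2 hT ha⟩ := by
  have restrictions_eq :
      f.comp (BooleanSubalgebra.inclusion (BooleanSubalgebra.closure_le.2 hS)) =
        g.comp (BooleanSubalgebra.inclusion (BooleanSubalgebra.closure_le.2 hT)) :=
    boundedLatticeHom_ext_closure h
  exact DFunLike.congr_fun restrictions_eq ⟨a, ha⟩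

end BooleanAlgebra

section FreeProducts

variable {n : ℕ∞} {I : Type v}

theorem isNFreeOver_iUnion_image {A : I → Type u} [∀ i, BooleanAlgebra (A i)] {F : Type t}
    [BooleanAlgebra F] {e : ∀ i, BoundedLatticeHom (A i) F} {H : ∀ i, Set (A i)}
    (hA : ∀ i, IsNFreeOver.{u, w} (A i) n (H i))
    (lift : ∀ (B : Type w) [BooleanAlgebra B] [Nontrivial B] (f : ∀ i, BoundedLatticeHom (A i) B),
      (∀ i j, ∀ x ∈ H i, ∀ y ∈ H j, e i x = e j y → f i x = f j y) →
      ∃! φ : BoundedLatticeHom F B, ∀ i, ∀ a : A i, φ (e i a) = f i a) :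
    IsNFreeOver.{t, w} F n (⋃ i, e i '' H i) where
  nontrivial := by
    have (i : I) : Nontrivial (A i) := (hA i).nontrivial
    choose g hg _ using fun i =>
      (hA i).existsUnique_extension (Set PUnit) (fun _ => ⊥) isPreserving_const_bot
    obtain ⟨φ, -, -⟩ := lift (Set PUnit) g fun i j x hx y hy _ =>
      (hg i ⟨x, hx⟩).trans (hg j ⟨y, hy⟩).symm
    exact nontrivial_of_boundedLatticeHom φ
  existsUnique_extension B _ _ f hf := by
    have mapsTo (i : I) : Set.MapsTo (e i) (H i) (⋃ i, e i '' H i) :=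
      fun x hx => Set.mem_iUnion_of_mem i (Set.mem_image_of_mem _ hx)
    choose g hg g_unique using fun i =>
      (hA i).existsUnique_extension B _ (hf.comp_mapsTo (e i) (mapsTo i))
    obtain ⟨φ, hφ, φ_unique⟩ := lift B g fun i j x hx y hy hxy =>
      calc
        g i x = f ⟨e i x, mapsTo i hx⟩ := hg i ⟨x, hx⟩
        _ = f ⟨e j y, mapsTo j hy⟩ := congrArg f (Subtype.ext hxy)
        _ = g j y := (hg j ⟨y, hy⟩).symm
    refine ⟨φ, ?_, fun ψ hψ => φ_unique ψ fun i a => ?_⟩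
    · rintro ⟨_, hx⟩
      obtain ⟨i, x, hxi, rfl⟩ := Set.mem_iUnion.1 hx
      exact (hφ i x).trans (hg i ⟨x, hxi⟩)
    · have comp_eq : ψ.comp (e i) = g i :=
        g_unique i (ψ.comp (e i)) fun x => hψ ⟨e i x, mapsTo i x.2⟩
      exact DFunLike.congr_fun comp_eq a

theorem IsAmalgamatedFreeProduct.isNFreeOver {A : Type u} [BooleanAlgebra A]
    {C : BooleanSubalgebra A} {S : I → BooleanSubalgebra A} {H : ∀ i, Set (S i)}
    (hA : IsAmalgamatedFreeProduct.{u, v, w} C S) (hS : ∀ i, IsNFreeOver.{u, w} (S i) n (H i))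
    (hC : ∀ i j, i ≠ j →
      C ≤ BooleanSubalgebra.closure ((S i).subtype '' H i ∩ (S j).subtype '' H j)) :
    IsNFreeOver.{u, w} A n (⋃ i, (S i).subtype '' H i) := by
  refine isNFreeOver_iUnion_image hS fun B _ _ f hf => hA.existsUnique_lift B f fun i j c => ?_
  rcases eq_or_ne i j with rfl | hij
  · rfl
  have image_subset (k : I) : (S k).subtype '' H k ⊆ S k :=
    Set.image_subset_iff.2 fun x _ => x.2
  refine apply_eq_apply_of_mem_closure (Set.inter_subset_left.trans (image_subset i))
    (Set.inter_subset_right.trans (image_subset j)) ?_ (hC i j hij c.2)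
  rintro _ ⟨⟨x, hx, rfl⟩, y, hy, hyx⟩
  calc
    f i x = f j y := hf i j x hx y hy hyx.symm
    _ = f j ⟨x, _⟩ := congrArg (f j) (Subtype.ext hyx)

variable {A : I → Type u} [∀ i, BooleanAlgebra (A i)] {F : Type t} [BooleanAlgebra F]
  {e : ∀ i, BoundedLatticeHom (A i) F}

theorem IsFreeProduct.isNFreeOver (he : IsFreeProduct.{u, v, w, t} e) {H : ∀ i, Set (A i)}
    (hA : ∀ i, IsNFreeOver.{u, w} (A i) n (H i)) : IsNFreeOver.{t, w} F n (⋃ i, e i '' H i) :=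
  isNFreeOver_iUnion_image hA fun B _ _ f _ => he B f

theorem IsFreeProduct.isNFree (he : IsFreeProduct.{u, v, w, t} e)
    (hA : ∀ i, IsNFree.{u, w} (A i) n) : IsNFree.{t, w} F n := by
  choose H hH using hA
  exact ⟨_, he.isNFreeOver hH⟩

end FreeProducts

section GraphSpaces

variable {I : Type v} {V : I → Type u}

/-- The join of a family of graphs, whose clique space is the product of their clique spaces: their
disjoint union, together with all edges between vertices of different graphs. -/
def sigmaJoin (G : ∀ i, SimpleGraph (V i)) : SimpleGraph (Σ i, V i) :=
  SimpleGraph.completeMultipartiteGraph V ⊔ ⨆ i, (G i).map (Function.Embedding.sigmaMk i)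

variable (G : ∀ i, SimpleGraph (V i))

theorem sigmaJoin_adj_of_ne {i j : I} (hij : i ≠ j) (a : V i) (b : V j) :
    (sigmaJoin G).Adj ⟨i, a⟩ ⟨j, b⟩ :=
  Or.inl hij

theorem sigmaJoin_adj_mk {i : I} {a b : V i} :
    (sigmaJoin G).Adj ⟨i, a⟩ ⟨i, b⟩ ↔ (G i).Adj a b := by
  simp only [sigmaJoin, SimpleGraph.sup_adj, SimpleGraph.comap_adj, SimpleGraph.top_adj, ne_eq,
    not_true_eq_false, false_or, SimpleGraph.iSup_adj, SimpleGraph.map_adj]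
  constructor
  · rintro ⟨_, _, _, hab, ⟨⟩, ⟨⟩⟩
    exact hab
  · exact fun hab => ⟨i, a, b, hab, rfl, rfl⟩

theorem mem_cliqueSpace_sigmaJoin {f : (Σ i, V i) → Bool} :
    f ∈ cliqueSpace (sigmaJoin G) ↔ ∀ i, (fun a => f ⟨i, a⟩) ∈ cliqueSpace (G i) := by
  constructor
  · intro hf i a ha b hb hab
    exact (sigmaJoin_adj_mk G).1 (hf (x := ⟨i, a⟩) ha (y := ⟨i, b⟩) hb (by simpa using hab))
  · rintro hf ⟨i, a⟩ ha ⟨j, b⟩ hb hab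
    rcases eq_or_ne i j with rfl | hij
    · exact (sigmaJoin_adj_mk G).2 (hf i ha hb (by simpa using hab))
    · exact sigmaJoin_adj_of_ne G hij a b

/-- The homeomorphism between the product of the clique spaces of a family of graphs and the clique
space of their join, which sends a family of cliques to its disjoint union. -/
def piCliqueSpaceHomeomorph : (∀ i, cliqueSpace (G i)) ≃ₜ cliqueSpace (sigmaJoin G) where
  toFun f := ⟨fun x => (f x.1).1 x.2, (mem_cliqueSpace_sigmaJoin G).2 fun i => (f i).2⟩
  invFun f i := ⟨fun a => f.1 ⟨i, a⟩, (mem_cliqueSpace_sigmaJoin G).1 f.2 i⟩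
  left_inv _ := rfl
  right_inv _ := rfl
  continuous_toFun := Continuous.subtype_mk (continuous_pi fun x =>
    (continuous_apply x.2).comp (continuous_subtype_val.comp (continuous_apply x.1))) _
  continuous_invFun := by
    refine continuous_pi fun i => Continuous.subtype_mk (continuous_pi fun a => ?_) _
    exact (continuous_apply (⟨i, a⟩ : Σ i, V i)).comp continuous_subtype_val

theorem IsGraphSpace.pi {X : I → Type u} [∀ i, TopologicalSpace (X i)]
    (hX : ∀ i, IsGraphSpace (X i)) : IsGraphSpace (∀ i, X i) := by
  choose V G hG using hX
  exact ⟨_, _, ⟨(Homeomorph.piCongrRight fun i => (hG i).some).trans (piCliqueSpaceHomeomorph G)⟩⟩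

end GraphSpaces

theorem mainTheorem5 :
    -- amalgamated free products
    (∀ (n : ℕ∞), 1 ≤ n → ∀ (A : Type u) [BooleanAlgebra A] (I : Type v)
      (C : BooleanSubalgebra A) (S : I → BooleanSubalgebra A) (H : ∀ i, Set (S i)),
      IsAmalgamatedFreeProduct.{u, v, w} C S →
      (∀ i j, i ≠ j → S i ⊓ S j = C) →
      (∀ i, IsNFreeOver.{u, w} (S i) n (H i)) →
      (∀ i j, i ≠ j →
        C ≤ BooleanSubalgebra.closure
          (((fun a : S i => (a : A)) '' H i) ∩ ((fun a : S j => (a : A)) '' H j))) →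
      IsNFreeOver.{u, w} A n (⋃ i, (fun a : S i => (a : A)) '' H i)) ∧
    -- free products
    (∀ (n : ℕ∞), 1 ≤ n → ∀ (I : Type v) (A : I → Type u) [∀ i, BooleanAlgebra (A i)]
      (F : Type t) [BooleanAlgebra F] (e : ∀ i, BoundedLatticeHom (A i) F),
      IsFreeProduct.{u, v, w, t} e →
      (∀ H : ∀ i, Set (A i), (∀ i, IsNFreeOver.{u, w} (A i) n (H i)) →
        IsNFreeOver.{t, w} F n (⋃ i, e i '' H i)) ∧
      ((∀ i, IsNFree.{u, w} (A i) n) → IsNFree.{t, w} F n)) ∧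
    -- products of graph spaces
    (∀ (I : Type v) (X : I → Type u) [∀ i, TopologicalSpace (X i)],
      (∀ i, IsGraphSpace (X i)) → IsGraphSpace (∀ i, X i)) := by
  refine ⟨?_, ?_, ?_⟩
  · exact fun n _ A _ I C S H hA _ hS hC => hA.isNFreeOver hS hC
  · exact fun n _ I A _ F _ e he => ⟨fun H hA => he.isNFreeOver hA, he.isNFree⟩
  · exact fun I X _ hX => IsGraphSpace.pi hX
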